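/- Let $\mathcal A,\mathcal B,\mathcal X,\mathcal Y$ be finite sets. A two-player game is a pair $(q,H)$ with $q\colon\mathcal A\times\mathcal B\to[0,1]$ a probability distribution and $H\colon\mathcal A\times\mathcal B\times\mathcal X\times\mathcal Y\to[0,1]$ a function; it has complete support if $q(a,b)\neq 0$ for all $a,b$. A (two-player) strategy is a tuple $\Gamma=(D,E,\{\{R_a^x\}_x\}_a,\{\{S_b^y\}_y\}_b,\gamma)$, where $D,E$ are finite-dimensional complex Hilbert spaces, $\{R_a^x\}_{x\in\mathcal X}$ is a POVM on $D$ for each $a\in\mathcal A$, $\{S_b^y\}_{y\in\mathcal Y}$ is a POVM on $E$ for each $b\in\mathcal B$, and $\gamma$ is a density operator on $D\otimes E$. Its second-player states are $$\rho_{ab}^{xy}=\operatorname{Tr}_D\Big[\sqrt{R_a^x\otimes S_b^y}\,\gamma\,\sqrt{R_a^x\otimes S_b^y}\Big].$$ The strategy allows perfect guessing if for all $a,b,y$ and all $x\neq x'$ the operators $\rho_{ab}^{xy}$ and $\rho_{ab}^{x'y}$ have orthogonal supports. A unitary embedding of $\Gamma$ into $\overline\Gamma=(\overline D,\overline E,\{\overline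 R_a^x\},\{\overline S_b^y\},\overline\gamma)$ is a pair of linear isometries $i\colon D\to\overline D$, $j\colon E\to\overline E$ with $\overline\gamma=(i\otimes j)\gamma(i\otimes j)^*$, $R_a^x=i^*\overline R_a^x i$ and $S_b^y=j^*\overline S_b^y j$ for all $a,b,x,y$. If $D=D_1\otimes D_2$ and $R_a^x=G_a^x\otimes \mathbb I$ for all $a,x$, then $(D_1,E,\{G_a^x\},\{S_b^y\},\operatorname{Tr}_{D_2}\gamma)$ is called a partial trace of $\Gamma$; partial traces on a tensor factor of $E$ are defined in the same way. Two strategies $\Gamma,\Gamma'$ are congruent if there is a finite sequence of strategies $\Gamma=\Gamma_1,\dots,\Gamma_n=\Gamma'$ such that for each $k<n$ one of $\Gamma_k,\Gamma_{k+1}$ is a partial trace of the other or has a unitary embedding into the other. A strategy is essentially classical if it is congruent to a strategy whose shared state $\gamma$ commutes with $R_a^x\otimes\mathbb I$ for all $a,x$. Theorem. If a strategy for a complete-support game allows perfect guessing, then it is essentially classical. -/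

import Mathlib

open scoped Kronecker ComplexOrder MatrixOrder

noncomputable section

namespace GuessingGame

/-- A two-player game with input alphabets `A`, `B` and output alphabets `X`, `Y`: a probability
distribution `q` on the pairs of inputs and a scoring function `H` with values in `[0, 1]`. -/
structure Game (A B X Y : Type*) [Fintype A] [Fintype B] where
  q : A → B → ℝ
  q_nonneg : ∀ a b, 0 ≤ q a b
  q_sum : ∑ a, ∑ b, q a b = 1
  H : A → B → X → Y → ℝ
  H_mem : ∀ a b x y, H a b x y ∈ Set.Icc (0 : ℝ) 1

/-- Every pair of inputs occurs with nonzero probability. -/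
def Game.CompleteSupport {A B X Y : Type*} [Fintype A] [Fintype B] (G : Game A B X Y) : Prop :=
  ∀ a b, G.q a b ≠ 0

/-- An `X`-valued positive operator valued measure on the Hilbert space `ℂ^D`. -/
structure POVM (X D : Type*) [Fintype X] [Fintype D] [DecidableEq D] where
  op : X → Matrix D D ℂ
  posSemidef : ∀ x, (op x).PosSemidef
  sum_eq_one : ∑ x, op x = 1

/-- The partial trace over the first tensor factor of `ℂ^D ⊗ ℂ^E = ℂ^(D × E)`. -/
def traceFirst {D E : Type*} [Fintype D] (M : Matrix (D × E) (D × E) ℂ) : Matrix E E ℂ :=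
  Matrix.of fun e e' => ∑ d, M (d, e) (d, e')

/-- The support of an operator on the Hilbert space `ℂ^V`: the orthogonal complement of its
kernel. -/
def support {V : Type*} [Fintype V] [DecidableEq V] (M : Matrix V V ℂ) :
    Submodule ℂ (EuclideanSpace ℂ V) :=
  (LinearMap.ker (Matrix.toEuclideanLin M))ᗮ

/-- A family of (positive semidefinite) operators is perfectly distinguishable if its members
have pairwise orthogonal supports. -/
def PerfectlyDistinguishable {ι V : Type*} [Fintype V] [DecidableEq V]
    (χ : ι → Matrix V V ℂ) : Prop :=
  ∀ i j, i ≠ j → support (χ i) ⟂ support (χ j)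

/-- A two-player strategy on the finite-dimensional Hilbert spaces `ℂ^D` (first player) and `ℂ^E`
(second player): a family `R` of `X`-valued POVMs on `ℂ^D` indexed by `A`, a family `S` of
`Y`-valued POVMs on `ℂ^E` indexed by `B`, and a density operator `γ` on `ℂ^D ⊗ ℂ^E`. -/
structure Strategy (A B X Y : Type*) [Fintype X] [Fintype Y]
    (D E : Type) [Fintype D] [DecidableEq D] [Fintype E] [DecidableEq E] where
  R : A → POVM X D
  S : B → POVM Y E
  γ : Matrix (D × E) (D × E) ℂ
  γ_posSemidef : γ.PosSemidef
  γ_trace : γ.trace = 1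

section

variable {A B X Y : Type*} [Fintype X] [Fintype Y]
variable {D E D' E' : Type} [Fintype D] [DecidableEq D] [Fintype E] [DecidableEq E]
  [Fintype D'] [DecidableEq D'] [Fintype E'] [DecidableEq E']
variable {D₁ D₂ E₁ E₂ : Type} [Fintype D₁] [DecidableEq D₁] [Fintype D₂] [DecidableEq D₂]
  [Fintype E₁] [DecidableEq E₁] [Fintype E₂] [DecidableEq E₂]

/-- The second-player state `ρ_{ab}^{xy} = Tr_D [√(R_a^x ⊗ S_b^y) γ √(R_a^x ⊗ S_b^y)]`. -/
def Strategy.secondPlayerState (Γ : Strategy A B X Y D E) (a : A) (b : B) (x : X) (y : Y) :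
    Matrix E E ℂ :=
  traceFirst (CFC.sqrt ((Γ.R a).op x ⊗ₖ (Γ.S b).op y) * Γ.γ *
    CFC.sqrt ((Γ.R a).op x ⊗ₖ (Γ.S b).op y))

/-- The second player can guess perfectly: for all `a`, `b`, `y` the family `(ρ_{ab}^{xy})_x` is
perfectly distinguishable. -/
def Strategy.AllowsPerfectGuessing (Γ : Strategy A B X Y D E) : Prop :=
  ∀ a b y, PerfectlyDistinguishable fun x => Γ.secondPlayerState a b x y

/-- `i` and `j` are (the matrices of) isometries that embed the strategy `Γ` into `Γ'`. -/
structure IsUnitaryEmbedding (Γ : Strategy A B X Y D E) (Γ' : Strategy A B X Y D' E')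
    (i : Matrix D' D ℂ) (j : Matrix E' E ℂ) : Prop where
  isometry_left : i.conjTranspose * i = 1
  isometry_right : j.conjTranspose * j = 1
  state : Γ'.γ = (i ⊗ₖ j) * Γ.γ * (i ⊗ₖ j).conjTranspose
  left : ∀ a x, (Γ.R a).op x = i.conjTranspose * (Γ'.R a).op x * i
  right : ∀ b y, (Γ.S b).op y = j.conjTranspose * (Γ'.S b).op y * j

/-- `Γ'` arises from `Γ` by tracing out the factor `D₂` of the first player's space
`ℂ^D₁ ⊗ ℂ^D₂`, on which her measurements act trivially. -/
structure IsPartialTraceLeft (Γ : Strategy A B X Y (D₁ × D₂) E)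
    (Γ' : Strategy A B X Y D₁ E) : Prop where
  left : ∀ a x, (Γ.R a).op x = (Γ'.R a).op x ⊗ₖ (1 : Matrix D₂ D₂ ℂ)
  right : ∀ b y, (Γ.S b).op y = (Γ'.S b).op y
  state : ∀ d e d' e', Γ'.γ (d, e) (d', e') = ∑ t, Γ.γ ((d, t), e) ((d', t), e')

/-- `Γ'` arises from `Γ` by tracing out the factor `E₂` of the second player's space
`ℂ^E₁ ⊗ ℂ^E₂`, on which his measurements act trivially. -/
structure IsPartialTraceRight (Γ : Strategy A B X Y D (E₁ × E₂))
    (Γ' : Strategy A B X Y D E₁) : Prop where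
  left : ∀ a x, (Γ.R a).op x = (Γ'.R a).op x
  right : ∀ b y, (Γ.S b).op y = (Γ'.S b).op y ⊗ₖ (1 : Matrix E₂ E₂ ℂ)
  state : ∀ d e d' e', Γ'.γ (d, e) (d', e') = ∑ t, Γ.γ (d, (e, t)) (d', (e', t))

end

/-- A strategy together with its Hilbert spaces, so that strategies on different spaces can be
compared. -/
structure SomeStrategy (A B X Y : Type*) [Fintype X] [Fintype Y] where
  {D E : Type}
  [fintypeD : Fintype D]
  [decidableEqD : DecidableEq D]
  [fintypeE : Fintype E]
  [decidableEqE : DecidableEq E]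
  strategy : Strategy A B X Y D E

/-- The elementary moves between strategies: a unitary embedding of the first into the second, or
the second is a partial trace of the first. -/
inductive Step {A B X Y : Type*} [Fintype X] [Fintype Y] :
    SomeStrategy A B X Y → SomeStrategy A B X Y → Prop
  | embedding {D E D' E' : Type} [Fintype D] [DecidableEq D] [Fintype E] [DecidableEq E]
      [Fintype D'] [DecidableEq D'] [Fintype E'] [DecidableEq E']
      (Γ : Strategy A B X Y D E) (Γ' : Strategy A B X Y D' E')
      (i : Matrix D' D ℂ) (j : Matrix E' E ℂ) (h : IsUnitaryEmbedding Γ Γ' i j) :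
      Step ⟨Γ⟩ ⟨Γ'⟩
  | traceLeft {D₁ D₂ E : Type} [Fintype D₁] [DecidableEq D₁] [Fintype D₂] [DecidableEq D₂]
      [Fintype E] [DecidableEq E]
      (Γ : Strategy A B X Y (D₁ × D₂) E) (Γ' : Strategy A B X Y D₁ E)
      (h : IsPartialTraceLeft Γ Γ') : Step ⟨Γ⟩ ⟨Γ'⟩
  | traceRight {D E₁ E₂ : Type} [Fintype D] [DecidableEq D] [Fintype E₁] [DecidableEq E₁]
      [Fintype E₂] [DecidableEq E₂]
      (Γ : Strategy A B X Y D (E₁ × E₂)) (Γ' : Strategy A B X Y D E₁)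
      (h : IsPartialTraceRight Γ Γ') : Step ⟨Γ⟩ ⟨Γ'⟩

/-- Two strategies are congruent if a finite sequence of elementary moves, each taken in either
direction, leads from one to the other. -/
def Congruent {A B X Y : Type*} [Fintype X] [Fintype Y]
    (Γ Γ' : SomeStrategy A B X Y) : Prop :=
  Relation.ReflTransGen (fun Γ₁ Γ₂ => Step Γ₁ Γ₂ ∨ Step Γ₂ Γ₁) Γ Γ'

/-- A strategy is essentially classical if it is congruent to one whose shared state commutes with
all measurement operators `R_a^x` (that is, `R_a^x ⊗ 1`) of the first player. -/
def Strategy.EssentiallyClassical {A B X Y : Type*} [Fintype X] [Fintype Y]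
    {D E : Type} [Fintype D] [DecidableEq D] [Fintype E] [DecidableEq E]
    (Γ : Strategy A B X Y D E) : Prop :=
  ∃ (D' E' : Type) (_ : Fintype D') (_ : DecidableEq D') (_ : Fintype E') (_ : DecidableEq E')
    (Γ' : Strategy A B X Y D' E'),
    Congruent ⟨Γ⟩ ⟨Γ'⟩ ∧ ∀ a x, Commute Γ'.γ ((Γ'.R a).op x ⊗ₖ (1 : Matrix E' E' ℂ))

end GuessingGame

end

/-!
Write `σ_a^x = Tr_D [(R_a^x ⊗ 1) γ]` for the unnormalised states of the second player before he
measures, and `σ = ∑ x, σ_a^x = Tr_D γ`. Since `ρ_{ab}^{xy} = √S_b^y σ_a^x √S_b^y`, perfect guessing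
says that `σ_a^x S_b^y σ_a^{x'} = 0` for `x ≠ x'`
(`Strategy.AllowsPerfectGuessing.steeredOrthogonal`).

Restricting the second player to the support of `σ` is the inverse of a unitary embedding, so `σ`
may be taken invertible. Then the `P_a^x = σ_a^x σ⁻¹` form a projective measurement for each `a`,
they commute with all `S_b^y`, and their outcome is perfectly correlated with that of `R_a`, so that
`(R_a^x ⊗ 1) γ = (1 ⊗ P_a^x) γ` (`Strategy.SteeredOrthogonal.exists_mirror`).

It remains to trace out the part of the second player's space on which the `P_a^x` act. Instead of
the structure theorem for finite-dimensional C*-algebras, the argument uses the action of the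
commutant `V` of the `S_b^y` on itself by left multiplication: let `e_l` be a Hilbert–Schmidt
orthonormal basis of `V`, put `T = ∑ l, e_l e_lᴴ` and `f_l = T^(-1/2) e_l`. The isometry
`v ↦ ∑ l, f_lᴴ v ⊗ |l⟩` of `ℂ^E` into `ℂ^E ⊗ ℂ^k` intertwines `S_b^y` with `S_b^y ⊗ 1`, and `P_a^x`
with `1 ⊗ L` for a Hermitian matrix `L` (`exists_frame_commutant`). Tracing out `ℂ^k` is therefore a
legitimate move, and by cyclicity of the partial trace in the operator `L` the resulting state
commutes with `R_a^x ⊗ 1` (`Strategy.essentiallyClassical_of_mirror`).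
-/

noncomputable section

namespace GuessingGame

/-! ### Positive semidefinite matrices -/

section PosSemidef

variable {m n : Type*} [Fintype m] [DecidableEq m] [Fintype n] [DecidableEq n]

theorem posSemidef_sqrt (M : Matrix n n ℂ) : (CFC.sqrt M).PosSemidef :=
  Matrix.nonneg_iff_posSemidef.1 (CFC.sqrt_nonneg M)

theorem conjTranspose_sqrt (M : Matrix n n ℂ) : (CFC.sqrt M).conjTranspose = CFC.sqrt M :=
  (posSemidef_sqrt M).isHermitian

theorem sqrt_mul_sqrt_self {M : Matrix n n ℂ} (hM : M.PosSemidef) :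
    CFC.sqrt M * CFC.sqrt M = M :=
  CFC.sqrt_mul_sqrt_self M hM.nonneg

theorem sqrt_kronecker {M : Matrix m m ℂ} {N : Matrix n n ℂ} (hM : M.PosSemidef)
    (hN : N.PosSemidef) : CFC.sqrt (M ⊗ₖ N) = CFC.sqrt M ⊗ₖ CFC.sqrt N :=
  CFC.sqrt_unique
    (by rw [← Matrix.mul_kronecker_mul, sqrt_mul_sqrt_self hM, sqrt_mul_sqrt_self hN])
    ((posSemidef_sqrt M).kronecker (posSemidef_sqrt N)).nonneg

/-- Positive semidefinite matrices that are orthogonal in the trace inner product have product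
zero. -/
theorem mul_eq_zero_of_trace_mul_eq_zero {M N : Matrix n n ℂ} (hM : M.PosSemidef)
    (hN : N.PosSemidef) (h : (M * N).trace = 0) : M * N = 0 := by
  have h0 : ((CFC.sqrt M * CFC.sqrt N).conjTranspose * (CFC.sqrt M * CFC.sqrt N)).trace = 0 := by
    rw [Matrix.conjTranspose_mul, conjTranspose_sqrt, conjTranspose_sqrt, Matrix.mul_assoc,
      Matrix.trace_mul_comm, ← Matrix.mul_assoc, sqrt_mul_sqrt_self hM, Matrix.mul_assoc,
      sqrt_mul_sqrt_self hN, h]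
  rw [Matrix.trace_conjTranspose_mul_self_eq_zero_iff] at h0
  rw [← sqrt_mul_sqrt_self hM, ← sqrt_mul_sqrt_self hN, Matrix.mul_assoc,
    ← Matrix.mul_assoc (CFC.sqrt M) (CFC.sqrt N), h0, Matrix.zero_mul, Matrix.mul_zero]

/-- If the compressions `s M s` and `s N s` of positive semidefinite `M`, `N` have product zero,
then already `M s² N = 0`. -/
theorem mul_sq_mul_eq_zero {M N s : Matrix n n ℂ} (hM : M.PosSemidef) (hN : N.PosSemidef)
    (hs : s.IsHermitian) (h : s * M * s * (s * N * s) = 0) : M * (s * s) * N = 0 := by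
  set r := CFC.sqrt M
  set t := CFC.sqrt N
  have hr : r.conjTranspose = r := conjTranspose_sqrt M
  have ht : t.conjTranspose = t := conjTranspose_sqrt N
  have hr2 : r * r = M := sqrt_mul_sqrt_self hM
  have ht2 : t * t = N := sqrt_mul_sqrt_self hN
  -- `s M s = (r s)ᴴ (r s)` and `s N s = (s t) (s t)ᴴ`, so both outer factors cancel.
  have h1 : (r * s).conjTranspose * (r * s) * (s * N * s) = 0 := by
    rw [Matrix.conjTranspose_mul, hr, hs.eq, ← h, ← hr2]
    simp only [Matrix.mul_assoc]
  rw [Matrix.conjTranspose_mul_self_mul_eq_zero] at h1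
  have h2 : (r * s) * ((s * t) * (s * t).conjTranspose) = 0 := by
    rw [Matrix.conjTranspose_mul, ht, hs.eq, ← h1, ← ht2]
    simp only [Matrix.mul_assoc]
  rw [Matrix.mul_self_mul_conjTranspose_eq_zero] at h2
  calc M * (s * s) * N = r * (r * s * (s * t)) * t := by
        rw [← hr2, ← ht2]; simp only [Matrix.mul_assoc]
    _ = 0 := by rw [h2, Matrix.mul_zero, Matrix.zero_mul]

/-- Hermitian matrices with orthogonal supports have product zero: a Hermitian matrix takes its
values in its support. -/
theorem mul_eq_zero_of_support_isOrtho {M N : Matrix n n ℂ} (hM : M.IsHermitian)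
    (hN : N.IsHermitian) (h : support M ⟂ support N) : M * N = 0 := by
  have key : ∀ {K : Matrix n n ℂ}, K.IsHermitian → ∀ v, Matrix.toEuclideanLin K v ∈ support K := by
    intro K hK v
    rw [support, Submodule.mem_orthogonal]
    intro u hu
    rw [LinearMap.mem_ker] at hu
    rw [← (Matrix.isSymmetric_toEuclideanLin_iff.2 hK) u v, hu, inner_zero_left]
  rw [Submodule.isOrtho_iff_inner_eq] at h
  apply Matrix.toEuclideanLin.injective
  rw [map_zero]
  ext1 v
  have h2 : Matrix.toEuclideanLin (M * N) v
      = Matrix.toEuclideanLin M (Matrix.toEuclideanLin N v) := by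
    simp [Matrix.toEuclideanLin]
  rw [h2, LinearMap.zero_apply, ← inner_self_eq_zero (𝕜 := ℂ),
    Matrix.isSymmetric_toEuclideanLin_iff.2 hM, ← inner_conj_symm,
    h _ (key hM _) _ (key hN _), map_zero]

/-- Spectral decomposition of a Hermitian matrix on its support: `j` has the eigenvectors with
nonzero eigenvalue as columns, and `L` is the diagonal matrix of these eigenvalues. -/
theorem exists_isometry_onto_support {V : Type} [Fintype V] [DecidableEq V] {M : Matrix V V ℂ}
    (hM : M.IsHermitian) :
    ∃ (W : Type) (_ : Fintype W) (_ : DecidableEq W) (j : Matrix V W ℂ) (L : Matrix W W ℂ),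
      j.conjTranspose * j = 1 ∧ IsUnit L ∧ M = j * L * j.conjTranspose := by
  classical
  let U : Matrix V V ℂ := hM.eigenvectorUnitary
  have hU : U.conjTranspose * U = 1 := Unitary.coe_star_mul_self hM.eigenvectorUnitary
  let W := {v : V // hM.eigenvalues v ≠ 0}
  refine ⟨W, inferInstance, inferInstance, U.submatrix id Subtype.val,
    Matrix.diagonal fun w : W => (hM.eigenvalues w : ℂ), ?_, ?_, ?_⟩
  · rw [Matrix.conjTranspose_submatrix, ← Matrix.submatrix_mul _ _ _ _ _ Function.bijective_id, hU,
      Matrix.submatrix_one _ Subtype.val_injective]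
  · rw [Matrix.isUnit_diagonal, Pi.isUnit_iff]
    intro w
    simpa using w.2
  · ext v v'
    have h := congrFun (congrFun hM.spectral_theorem v) v'
    rw [Unitary.conjStarAlgAut_apply] at h
    rw [h, Matrix.mul_apply, Matrix.mul_apply]
    symm
    refine Fintype.sum_of_injective Subtype.val Subtype.val_injective _ _ ?_ ?_
    · intro v₀ hv₀
      have h0 : hM.eigenvalues v₀ = 0 := by
        by_contra hne
        exact hv₀ ⟨⟨v₀, hne⟩, rfl⟩
      simp [h0]
    · intro w
      simp [U]

end PosSemidef

/-! ### The partial trace over the first factor -/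

section TraceFirst

variable {D E E' : Type*} [Fintype D]

theorem one_kronecker_mul_apply [DecidableEq D] [Fintype E] (s : Matrix E' E ℂ) {F : Type*}
    (M : Matrix (D × E) F ℂ)
    (d : D) (e : E') (f : F) :
    ((1 : Matrix D D ℂ) ⊗ₖ s * M) (d, e) f = ∑ e₁, s e e₁ * M (d, e₁) f := by
  simp [Matrix.mul_apply, Fintype.sum_prod_type, Matrix.one_apply]

theorem mul_one_kronecker_apply [DecidableEq D] [Fintype E] (s : Matrix E E' ℂ) {F : Type*}
    (M : Matrix F (D × E) ℂ)
    (d : D) (e : E') (f : F) :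
    (M * (1 : Matrix D D ℂ) ⊗ₖ s) f (d, e) = ∑ e₁, M f (d, e₁) * s e₁ e := by
  simp [Matrix.mul_apply, Fintype.sum_prod_type, Matrix.one_apply]

theorem traceFirst_one_kronecker_mul [DecidableEq D] [Fintype E] (s : Matrix E' E ℂ)
    (M : Matrix (D × E) (D × E') ℂ) :
    traceFirst ((1 : Matrix D D ℂ) ⊗ₖ s * M) = s * Matrix.of fun e e' => ∑ d, M (d, e) (d, e') := by
  ext e e'
  simp only [traceFirst, Matrix.of_apply, one_kronecker_mul_apply]
  simp only [Matrix.mul_apply, Matrix.of_apply, Finset.mul_sum]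
  exact Finset.sum_comm

theorem traceFirst_compress [DecidableEq D] [Fintype E] (s : Matrix E' E ℂ) (t : Matrix E E' ℂ)
    (M : Matrix (D × E) (D × E) ℂ) :
    traceFirst ((1 : Matrix D D ℂ) ⊗ₖ s * M * (1 : Matrix D D ℂ) ⊗ₖ t) = s * traceFirst M * t := by
  rw [Matrix.mul_assoc, traceFirst_one_kronecker_mul, Matrix.mul_assoc]
  congr 1
  ext e e'
  simp only [traceFirst, Matrix.of_apply, mul_one_kronecker_apply]
  simp only [Matrix.mul_apply, Matrix.of_apply, Finset.sum_mul]
  exact Finset.sum_comm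

/-- Operators on the first factor may be moved cyclically under the partial trace. -/
theorem traceFirst_kronecker_one_mul [Fintype E] [DecidableEq E] (r : Matrix D D ℂ)
    (M : Matrix (D × E) (D × E) ℂ) :
    traceFirst (r ⊗ₖ (1 : Matrix E E ℂ) * M) = traceFirst (M * r ⊗ₖ (1 : Matrix E E ℂ)) := by
  ext e e'
  simp only [traceFirst, Matrix.of_apply, Matrix.mul_apply, Fintype.sum_prod_type,
    Matrix.kroneckerMap_apply, Matrix.one_apply, mul_ite, ite_mul, mul_one, mul_zero, zero_mul,
    Finset.sum_ite_eq, Finset.sum_ite_eq', Finset.mem_univ, if_true]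
  rw [Finset.sum_comm]
  simp only [mul_comm]

theorem trace_traceFirst [Fintype E] (M : Matrix (D × E) (D × E) ℂ) :
    (traceFirst M).trace = M.trace := by
  simp only [Matrix.trace, Matrix.diag_apply, traceFirst, Matrix.of_apply, Fintype.sum_prod_type]
  exact Finset.sum_comm

theorem posSemidef_traceFirst {M : Matrix (D × E) (D × E) ℂ} (hM : M.PosSemidef) :
    (traceFirst M).PosSemidef := by
  have h : traceFirst M = ∑ d, M.submatrix (fun e => (d, e)) (fun e => (d, e)) := by
    ext e e'
    simp [traceFirst, Matrix.sum_apply]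
  rw [h]
  exact Matrix.posSemidef_sum _ fun d _ => hM.submatrix _

/-- A positive semidefinite `M` on `ℂ^D ⊗ ℂ^E` lives on the support of its partial trace. -/
theorem one_kronecker_mul_eq_zero [DecidableEq D] [Fintype E] [DecidableEq E]
    {Q : Matrix E E ℂ} (hQ : Q.PosSemidef)
    {M : Matrix (D × E) (D × E) ℂ} (hM : M.PosSemidef) (h : Q * traceFirst M = 0) :
    (1 : Matrix D D ℂ) ⊗ₖ Q * M = 0 := by
  refine mul_eq_zero_of_trace_mul_eq_zero (Matrix.PosSemidef.one.kronecker hQ) hM ?_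
  rw [← trace_traceFirst, traceFirst_one_kronecker_mul]
  exact (congrArg Matrix.trace h).trans (Matrix.trace_zero _ _)

end TraceFirst

/-! ### Intertwining a commutant with a tensor factor -/

section Frame

open Matrix

variable {n : Type} [Fintype n] [DecidableEq n]

/-- A family in the commutant of the `s i`, with `1` in its span, with respect to which left
multiplication by any Hermitian element of the commutant has a Hermitian matrix: a Hilbert–Schmidt
orthonormal basis of the commutant will do. -/
theorem exists_family_commutant_hermitian_mul {ι : Type*} (s : ι → Matrix n n ℂ) :
    ∃ (k : ℕ) (e : Fin k → Matrix n n ℂ), (∀ i l, Commute (s i) (e l)) ∧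
      (∃ c : Fin k → ℂ, ∑ l, c l • e l = 1) ∧
      ∀ p : Matrix n n ℂ, p.IsHermitian → (∀ i, Commute (s i) p) →
        ∃ L : Matrix (Fin k) (Fin k) ℂ, L.IsHermitian ∧ ∀ m, p * e m = ∑ l, L l m • e l := by
  let _ : NormedAddCommGroup (Matrix n n ℂ) := Matrix.toMatrixNormedAddCommGroup 1 Matrix.PosDef.one
  let _ : InnerProductSpace ℂ (Matrix n n ℂ) :=
    Matrix.toMatrixInnerProductSpace 1 Matrix.PosSemidef.one
  have inner_def : ∀ x y : Matrix n n ℂ, inner ℂ x y = (y * x.conjTranspose).trace := by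
    intro x y
    change (y * 1 * x.conjTranspose).trace = _
    rw [Matrix.mul_one]
  let V : Submodule ℂ (Matrix n n ℂ) :=
    Subalgebra.toSubmodule (Subalgebra.centralizer ℂ (Set.range s))
  have mem_V : ∀ {p : Matrix n n ℂ}, p ∈ V ↔ ∀ i, Commute (s i) p := by
    intro p
    simp [V, Subalgebra.mem_centralizer_iff, Commute, SemiconjBy]
  let b := stdOrthonormalBasis ℂ V
  have expand : ∀ p ∈ V, ∑ l, inner ℂ (b l : Matrix n n ℂ) p • (b l : Matrix n n ℂ) = p := by
    intro p hp
    have := congrArg Subtype.val (b.sum_repr' ⟨p, hp⟩)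
    simpa using this
  refine ⟨_, fun l => (b l : Matrix n n ℂ), fun i l => mem_V.1 (b l).2 i,
    ⟨fun l => inner ℂ (b l : Matrix n n ℂ) 1, expand 1 (mem_V.2 fun i => Commute.one_right _)⟩, ?_⟩
  intro p hp hps
  refine ⟨Matrix.of fun l m => inner ℂ (b l : Matrix n n ℂ) (p * (b m : Matrix n n ℂ)), ?_, ?_⟩
  · ext l m
    simp only [Matrix.conjTranspose_apply, Matrix.of_apply, inner_def]
    rw [← Matrix.trace_conjTranspose, Matrix.conjTranspose_mul, Matrix.conjTranspose_mul,
      Matrix.conjTranspose_conjTranspose, hp.eq, ← Matrix.mul_assoc, Matrix.trace_mul_comm,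
      ← Matrix.mul_assoc]
  · intro m
    exact (expand _ (mem_V.2 fun i => (hps i).mul_right (mem_V.1 (b m).2 i))).symm

/-- A normalised family in the commutant of the Hermitian matrices `s i`: the map
`v ↦ ∑ l, (f l)ᴴ v ⊗ |l⟩` is an isometry that carries each `s i` to `s i ⊗ 1`, and each Hermitian
`p` in the commutant to `1 ⊗ L` for a Hermitian `L`. -/
theorem exists_frame_commutant {ι : Type*} (s : ι → Matrix n n ℂ) (hs : ∀ i, (s i).IsHermitian) :
    ∃ (k : ℕ) (f : Fin k → Matrix n n ℂ), (∀ i l, Commute (s i) (f l)) ∧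
      (∑ l, f l * (f l).conjTranspose = 1) ∧
      ∀ p : Matrix n n ℂ, p.IsHermitian → (∀ i, Commute (s i) p) →
        ∃ L : Matrix (Fin k) (Fin k) ℂ, L.IsHermitian ∧ ∀ m, p * f m = ∑ l, L l m • f l := by
  obtain ⟨k, e, hse, ⟨c, hc⟩, he⟩ := exists_family_commutant_hermitian_mul s
  set T : Matrix n n ℂ := ∑ l, e l * (e l).conjTranspose with hT
  have hT0 : T.PosSemidef :=
    Matrix.posSemidef_sum _ fun l _ => Matrix.posSemidef_self_mul_conjTranspose (e l)
  -- A vector killed by `T` is killed by all `(e l)ᴴ`, hence by `1`, which is in their span.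
  have hTunit : IsUnit T := by
    rw [← Matrix.mulVec_injective_iff_isUnit]
    refine (injective_iff_map_eq_zero T.mulVecLin).2 fun v hv => ?_
    rw [Matrix.mulVecLin_apply] at hv
    have h0 : ∑ l, star v ⬝ᵥ ((e l * (e l).conjTranspose) *ᵥ v) = 0 := by
      rw [← dotProduct_sum, ← Matrix.sum_mulVec, ← hT, hv, dotProduct_zero]
    have hpos := fun l => Matrix.posSemidef_self_mul_conjTranspose (e l)
    rw [Finset.sum_eq_zero_iff_of_nonneg fun l _ => (hpos l).dotProduct_mulVec_nonneg v] at h0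
    have h1 : ∀ l, (e l).conjTranspose *ᵥ v = 0 := fun l =>
      (Matrix.self_mul_conjTranspose_mulVec_eq_zero _ _).1
        (((hpos l).dotProduct_mulVec_zero_iff v).1 (h0 l (Finset.mem_univ l)))
    have h2 : (1 : Matrix n n ℂ).conjTranspose *ᵥ v = 0 := by
      rw [← hc, Matrix.conjTranspose_sum, Matrix.sum_mulVec]
      refine Finset.sum_eq_zero fun l _ => ?_
      rw [Matrix.conjTranspose_smul, Matrix.smul_mulVec, h1, smul_zero]
    simpa using h2
  have hse' : ∀ i l, Commute (s i) (e l).conjTranspose := by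
    intro i l
    have := congrArg Matrix.conjTranspose (hse i l).eq
    rw [Matrix.conjTranspose_mul, Matrix.conjTranspose_mul, (hs i).eq] at this
    exact this.symm
  have hsT : ∀ i, Commute (s i) T := fun i =>
    Commute.sum_right _ _ _ fun l _ => (hse i l).mul_right (hse' i l)
  have hpT : ∀ p : Matrix n n ℂ, p.IsHermitian → (∀ i, Commute (s i) p) → Commute p T := by
    intro p hp hps
    obtain ⟨L, hL, h⟩ := he p hp hps
    have h' : ∀ m, (e m).conjTranspose * p = ∑ l, L m l • (e l).conjTranspose := by
      intro m
      have := congrArg Matrix.conjTranspose (h m)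
      rw [Matrix.conjTranspose_mul, hp.eq, Matrix.conjTranspose_sum] at this
      rw [this]
      refine Finset.sum_congr rfl fun l _ => ?_
      rw [Matrix.conjTranspose_smul, hL.apply]
    rw [commute_iff_eq, hT, Finset.mul_sum, Finset.sum_mul]
    simp only [← Matrix.mul_assoc, h]
    simp only [Matrix.mul_assoc, h', Finset.sum_mul, Finset.mul_sum, Matrix.smul_mul,
      Matrix.mul_smul]
    exact Finset.sum_comm
  -- `t = T^(-1/2)`
  obtain ⟨t, ht, htT, htc⟩ : ∃ t : Matrix n n ℂ, t.IsHermitian ∧ t * T * t = 1 ∧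
      ∀ p, Commute p T → Commute p t := by
    have hr2 := sqrt_mul_sqrt_self hT0
    have hr : IsUnit (CFC.sqrt T) := by
      rw [Matrix.isUnit_iff_isUnit_det] at hTunit ⊢
      rw [← hr2, Matrix.det_mul] at hTunit
      exact isUnit_of_mul_isUnit_left hTunit
    have hrd := (Matrix.isUnit_iff_isUnit_det _).1 hr
    refine ⟨(CFC.sqrt T)⁻¹, (posSemidef_sqrt T).isHermitian.inv, ?_, ?_⟩
    · nth_rw 2 [← hr2]
      rw [← Matrix.mul_assoc, Matrix.nonsing_inv_mul _ hrd, Matrix.one_mul,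
        Matrix.mul_nonsing_inv _ hrd]
    · intro p hp
      have h1 : Commute p (CFC.sqrt T) := by
        rw [CFC.sqrt_eq_cfc]
        exact (hp.symm.cfc_nnreal _).symm
      have h2 := h1.eq
      rw [commute_iff_eq]
      calc p * (CFC.sqrt T)⁻¹ = (CFC.sqrt T)⁻¹ * (CFC.sqrt T * p) * (CFC.sqrt T)⁻¹ := by
            rw [← Matrix.mul_assoc, Matrix.nonsing_inv_mul _ hrd, Matrix.one_mul]
        _ = (CFC.sqrt T)⁻¹ * p := by
            rw [← h2, Matrix.mul_assoc, Matrix.mul_assoc, Matrix.mul_nonsing_inv _ hrd,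
              Matrix.mul_one]
  refine ⟨k, fun l => t * e l, fun i l => (htc _ (hsT i)).mul_right (hse i l), ?_, ?_⟩
  · rw [← htT, hT, Finset.mul_sum, Finset.sum_mul]
    refine Finset.sum_congr rfl fun l _ => ?_
    rw [Matrix.conjTranspose_mul, ht.eq]
    simp only [Matrix.mul_assoc]
  · intro p hp hps
    obtain ⟨L, hL, h⟩ := he p hp hps
    refine ⟨L, hL, fun m => ?_⟩
    rw [← Matrix.mul_assoc, (htc p (hpT p hp hps)).eq, Matrix.mul_assoc, h, Finset.mul_sum]
    simp only [Matrix.mul_smul]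

end Frame

/-! ### The second player's unnormalised states -/

section Steered

variable {A B X Y : Type*} [Fintype X] [Fintype Y]
variable {D E : Type} [Fintype D] [DecidableEq D] [Fintype E] [DecidableEq E]

/-- The unnormalised state `Tr_D [(R_a^x ⊗ 1) γ]` of the second player, before he measures, when the
first player gets the outcome `x` on input `a`. -/
def Strategy.steered (Γ : Strategy A B X Y D E) (a : A) (x : X) : Matrix E E ℂ :=
  traceFirst ((Γ.R a).op x ⊗ₖ (1 : Matrix E E ℂ) * Γ.γ)

theorem Strategy.steered_eq (Γ : Strategy A B X Y D E) (a : A) (x : X) :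
    Γ.steered a x = traceFirst (CFC.sqrt ((Γ.R a).op x) ⊗ₖ (1 : Matrix E E ℂ) * Γ.γ *
      CFC.sqrt ((Γ.R a).op x) ⊗ₖ (1 : Matrix E E ℂ)) := by
  rw [← traceFirst_kronecker_one_mul, ← Matrix.mul_assoc, ← Matrix.mul_kronecker_mul,
    sqrt_mul_sqrt_self ((Γ.R a).posSemidef x), Matrix.one_mul, steered]

theorem Strategy.posSemidef_steered (Γ : Strategy A B X Y D E) (a : A) (x : X) :
    (Γ.steered a x).PosSemidef := by
  rw [Γ.steered_eq]
  have hs : (CFC.sqrt ((Γ.R a).op x) ⊗ₖ (1 : Matrix E E ℂ)).conjTranspose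
      = CFC.sqrt ((Γ.R a).op x) ⊗ₖ (1 : Matrix E E ℂ) := by
    rw [Matrix.conjTranspose_kronecker, conjTranspose_sqrt, Matrix.conjTranspose_one]
  refine posSemidef_traceFirst ?_
  have := Γ.γ_posSemidef.mul_mul_conjTranspose_same
    (CFC.sqrt ((Γ.R a).op x) ⊗ₖ (1 : Matrix E E ℂ))
  rwa [hs] at this

theorem Strategy.sum_steered (Γ : Strategy A B X Y D E) (a : A) :
    ∑ x, Γ.steered a x = traceFirst Γ.γ := by
  have h : ∑ x, (Γ.R a).op x ⊗ₖ (1 : Matrix E E ℂ) * Γ.γ = Γ.γ := by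
    rw [← Finset.sum_mul]
    have : ∑ x, (Γ.R a).op x ⊗ₖ (1 : Matrix E E ℂ) = 1 := by
      rw [← Matrix.one_kronecker_one, ← (Γ.R a).sum_eq_one]
      ext ⟨d, e⟩ ⟨d', e'⟩
      simp [Matrix.sum_apply, Finset.sum_mul]
    rw [this, Matrix.one_mul]
  conv_rhs => rw [← h]
  ext e e'
  simp only [steered, traceFirst, Matrix.of_apply, Matrix.sum_apply]
  exact Finset.sum_comm

theorem Strategy.secondPlayerState_eq (Γ : Strategy A B X Y D E) (a : A) (b : B) (x : X) (y : Y) :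
    Γ.secondPlayerState a b x y =
      CFC.sqrt ((Γ.S b).op y) * Γ.steered a x * CFC.sqrt ((Γ.S b).op y) := by
  set r := CFC.sqrt ((Γ.R a).op x) with hr
  set s := CFC.sqrt ((Γ.S b).op y)
  have h1 : r ⊗ₖ s = (1 : Matrix D D ℂ) ⊗ₖ s * r ⊗ₖ (1 : Matrix E E ℂ) := by
    rw [← Matrix.mul_kronecker_mul, Matrix.one_mul, Matrix.mul_one]
  have h2 : r ⊗ₖ s = r ⊗ₖ (1 : Matrix E E ℂ) * (1 : Matrix D D ℂ) ⊗ₖ s := by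
    rw [← Matrix.mul_kronecker_mul, Matrix.one_mul, Matrix.mul_one]
  rw [Γ.steered_eq, ← traceFirst_compress, secondPlayerState,
    sqrt_kronecker ((Γ.R a).posSemidef x) ((Γ.S b).posSemidef y)]
  congr 1
  change r ⊗ₖ s * Γ.γ * r ⊗ₖ s = _
  nth_rw 1 [h1]
  rw [h2]
  simp only [Matrix.mul_assoc, hr]

/-- Perfect guessing, freed of the square roots of the second player's measurement operators. -/
def Strategy.SteeredOrthogonal (Γ : Strategy A B X Y D E) : Prop :=
  ∀ a b y x x', x ≠ x' → Γ.steered a x * (Γ.S b).op y * Γ.steered a x' = 0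

theorem Strategy.AllowsPerfectGuessing.steeredOrthogonal {Γ : Strategy A B X Y D E}
    (h : Γ.AllowsPerfectGuessing) : Γ.SteeredOrthogonal := by
  intro a b y x x' hx
  have hs := posSemidef_sqrt ((Γ.S b).op y)
  have herm : ∀ x, (Γ.secondPlayerState a b x y).IsHermitian := by
    intro x
    rw [Γ.secondPlayerState_eq]
    have := (Γ.posSemidef_steered a x).mul_mul_conjTranspose_same (CFC.sqrt ((Γ.S b).op y))
    rw [conjTranspose_sqrt] at this
    exact this.isHermitian
  have h0 := mul_eq_zero_of_support_isOrtho (herm x) (herm x') (h a b y x x' hx)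
  rw [Γ.secondPlayerState_eq, Γ.secondPlayerState_eq] at h0
  have := mul_sq_mul_eq_zero (Γ.posSemidef_steered a x) (Γ.posSemidef_steered a x')
    hs.isHermitian h0
  rwa [sqrt_mul_sqrt_self ((Γ.S b).posSemidef y)] at this

end Steered

/-! ### Restriction to the support of the second player's state -/

section Restriction

variable {A B X Y : Type*} [Fintype X] [Fintype Y]
variable {D E F : Type} [Fintype D] [DecidableEq D] [Fintype E] [DecidableEq E]
  [Fintype F] [DecidableEq F]

/-- The compression of a POVM by an isometry `j`. -/
def POVM.compress {Y : Type*} [Fintype Y] (S : POVM Y E) (j : Matrix E F ℂ)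
    (hj : j.conjTranspose * j = 1) : POVM Y F where
  op y := j.conjTranspose * S.op y * j
  posSemidef y := (S.posSemidef y).conjTranspose_mul_mul_same j
  sum_eq_one := by
    rw [← Matrix.sum_mul, ← Matrix.mul_sum, S.sum_eq_one, Matrix.mul_one, hj]

/-- The strategy obtained by letting the second player work in the range of the isometry `j`, which
has to contain the support of his state. -/
def Strategy.restrict (Γ : Strategy A B X Y D E) (j : Matrix E F ℂ)
    (hj : j.conjTranspose * j = 1)
    (hγ : (1 : Matrix D D ℂ) ⊗ₖ (j * j.conjTranspose) * Γ.γ = Γ.γ) : Strategy A B X Y D F where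
  R := Γ.R
  S b := (Γ.S b).compress j hj
  γ := (1 : Matrix D D ℂ) ⊗ₖ j.conjTranspose * Γ.γ * (1 : Matrix D D ℂ) ⊗ₖ j
  γ_posSemidef := by
    have := Γ.γ_posSemidef.conjTranspose_mul_mul_same ((1 : Matrix D D ℂ) ⊗ₖ j)
    rwa [Matrix.conjTranspose_kronecker, Matrix.conjTranspose_one] at this
  γ_trace := by
    rw [Matrix.trace_mul_comm, ← Matrix.mul_assoc, ← Matrix.mul_kronecker_mul, Matrix.one_mul, hγ,
      Γ.γ_trace]

variable {Γ : Strategy A B X Y D E} {j : Matrix E F ℂ} (hj : j.conjTranspose * j = 1)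
  (hγ : (1 : Matrix D D ℂ) ⊗ₖ (j * j.conjTranspose) * Γ.γ = Γ.γ)

theorem mul_one_kronecker_eq_self {F : Type*} [Fintype F] {j : Matrix E F ℂ}
    (hγ : (1 : Matrix D D ℂ) ⊗ₖ (j * j.conjTranspose) * Γ.γ = Γ.γ) :
    Γ.γ * (1 : Matrix D D ℂ) ⊗ₖ (j * j.conjTranspose) = Γ.γ := by
  have := congrArg Matrix.conjTranspose hγ
  rwa [Matrix.conjTranspose_mul, Γ.γ_posSemidef.isHermitian.eq, Matrix.conjTranspose_kronecker,
    Matrix.conjTranspose_one, Matrix.conjTranspose_mul, Matrix.conjTranspose_conjTranspose] at this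

theorem Strategy.isUnitaryEmbedding_restrict :
    IsUnitaryEmbedding (Γ.restrict j hj hγ) Γ (1 : Matrix D D ℂ) j where
  isometry_left := by rw [Matrix.conjTranspose_one, Matrix.one_mul]
  isometry_right := hj
  state := by
    change Γ.γ = (1 : Matrix D D ℂ) ⊗ₖ j *
      ((1 : Matrix D D ℂ) ⊗ₖ j.conjTranspose * Γ.γ * (1 : Matrix D D ℂ) ⊗ₖ j) * _
    rw [Matrix.conjTranspose_kronecker, Matrix.conjTranspose_one]
    simp only [← Matrix.mul_assoc]
    rw [← Matrix.mul_kronecker_mul, Matrix.one_mul, hγ, Matrix.mul_assoc,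
      ← Matrix.mul_kronecker_mul, Matrix.one_mul, mul_one_kronecker_eq_self hγ]
  left a x := by rw [Matrix.conjTranspose_one, Matrix.one_mul, Matrix.mul_one]; rfl
  right b y := rfl

theorem Strategy.traceFirst_restrict :
    traceFirst (Γ.restrict j hj hγ).γ = j.conjTranspose * traceFirst Γ.γ * j :=
  traceFirst_compress _ _ _

theorem Strategy.steered_restrict (a : A) (x : X) :
    (Γ.restrict j hj hγ).steered a x = j.conjTranspose * Γ.steered a x * j := by
  rw [steered, steered, ← traceFirst_compress]
  congr 1
  change (Γ.R a).op x ⊗ₖ (1 : Matrix F F ℂ) *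
      ((1 : Matrix D D ℂ) ⊗ₖ j.conjTranspose * Γ.γ * (1 : Matrix D D ℂ) ⊗ₖ j) = _
  simp only [← Matrix.mul_assoc]
  rw [← Matrix.mul_kronecker_mul, ← Matrix.mul_kronecker_mul]
  simp only [Matrix.mul_one, Matrix.one_mul]

theorem Strategy.steered_mul_range_projection {F : Type*} [Fintype F] {j : Matrix E F ℂ}
    (hγ : (1 : Matrix D D ℂ) ⊗ₖ (j * j.conjTranspose) * Γ.γ = Γ.γ) (a : A) (x : X) :
    Γ.steered a x * (j * j.conjTranspose) = Γ.steered a x := by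
  have h := traceFirst_compress (1 : Matrix E E ℂ) (j * j.conjTranspose)
    ((Γ.R a).op x ⊗ₖ (1 : Matrix E E ℂ) * Γ.γ)
  rw [Matrix.one_kronecker_one, Matrix.one_mul, Matrix.one_mul, Matrix.mul_assoc,
    mul_one_kronecker_eq_self hγ] at h
  exact h.symm

theorem Strategy.SteeredOrthogonal.restrict (h : Γ.SteeredOrthogonal) :
    (Γ.restrict j hj hγ).SteeredOrthogonal := by
  intro a b y x x' hx
  have hl := Strategy.steered_mul_range_projection (Γ := Γ) hγ a
  have hr : j * j.conjTranspose * Γ.steered a x' = Γ.steered a x' := by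
    have := congrArg Matrix.conjTranspose (hl x')
    rwa [Matrix.conjTranspose_mul, (Γ.posSemidef_steered a x').isHermitian.eq,
      Matrix.conjTranspose_mul, Matrix.conjTranspose_conjTranspose] at this
  rw [Strategy.steered_restrict, Strategy.steered_restrict]
  calc j.conjTranspose * Γ.steered a x * j * (j.conjTranspose * (Γ.S b).op y * j) *
        (j.conjTranspose * Γ.steered a x' * j)
      = j.conjTranspose * (Γ.steered a x * (j * j.conjTranspose) * (Γ.S b).op y *
          (j * j.conjTranspose * Γ.steered a x')) * j := by simp only [Matrix.mul_assoc]
    _ = 0 := by rw [hl, hr, h a b y x x' hx, Matrix.mul_zero, Matrix.zero_mul]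

/-- The restriction to the support makes the second player's state invertible. -/
theorem Strategy.exists_restrict_isUnit (Γ : Strategy A B X Y D E) :
    ∃ (F : Type) (_ : Fintype F) (_ : DecidableEq F) (j : Matrix E F ℂ)
      (hj : j.conjTranspose * j = 1)
      (hγ : (1 : Matrix D D ℂ) ⊗ₖ (j * j.conjTranspose) * Γ.γ = Γ.γ),
      IsUnit (traceFirst (Γ.restrict j hj hγ).γ) := by
  obtain ⟨F, _, _, j, L, hj, hL, hσ⟩ :=
    exists_isometry_onto_support (posSemidef_traceFirst Γ.γ_posSemidef).isHermitian
  have hγ : (1 : Matrix D D ℂ) ⊗ₖ (j * j.conjTranspose) * Γ.γ = Γ.γ := by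
    have hQ : (1 - j * j.conjTranspose).PosSemidef := by
      have h : (1 - j * j.conjTranspose).conjTranspose * (1 - j * j.conjTranspose)
          = 1 - j * j.conjTranspose := by
        rw [Matrix.conjTranspose_sub, Matrix.conjTranspose_one, Matrix.conjTranspose_mul,
          Matrix.conjTranspose_conjTranspose, Matrix.mul_sub, Matrix.mul_one, Matrix.sub_mul,
          Matrix.one_mul, Matrix.mul_assoc j, ← Matrix.mul_assoc j.conjTranspose j, hj,
          Matrix.one_mul, sub_self, sub_zero]
      rw [← h]
      exact Matrix.posSemidef_conjTranspose_mul_self _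
    have h0 := one_kronecker_mul_eq_zero hQ Γ.γ_posSemidef (by
      rw [hσ, Matrix.sub_mul, Matrix.one_mul, Matrix.mul_assoc j L, Matrix.mul_assoc j,
        ← Matrix.mul_assoc j.conjTranspose, hj, Matrix.one_mul, sub_self])
    have h1 : (1 : Matrix D D ℂ) ⊗ₖ (1 - j * j.conjTranspose)
        = 1 - (1 : Matrix D D ℂ) ⊗ₖ (j * j.conjTranspose) := by
      rw [eq_sub_iff_add_eq, ← Matrix.kronecker_add, sub_add_cancel, Matrix.one_kronecker_one]
    rw [h1, Matrix.sub_mul, Matrix.one_mul, sub_eq_zero] at h0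
    exact h0.symm
  refine ⟨F, inferInstance, inferInstance, j, hj, hγ, ?_⟩
  rw [Strategy.traceFirst_restrict, hσ, Matrix.mul_assoc, Matrix.mul_assoc, hj, Matrix.mul_one,
    ← Matrix.mul_assoc, hj, Matrix.one_mul]
  exact hL

end Restriction

/-! ### Mirroring the first player's measurements on the second player's side -/

section Mirror

variable {A B X Y : Type*} [Fintype X] [Fintype Y]
variable {D E : Type} [Fintype D] [DecidableEq D] [Fintype E] [DecidableEq E]

/-- If the second player's state `σ` is invertible, then `P_a^x = σ_a^x σ⁻¹`, the projection onto
the support of `σ_a^x`, commutes with all his measurements, and on the shared state it has the same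
effect as the first player's operator `R_a^x`. -/
theorem Strategy.SteeredOrthogonal.exists_mirror [Nonempty B] {Γ : Strategy A B X Y D E}
    (h : Γ.SteeredOrthogonal) (hσ : IsUnit (traceFirst Γ.γ)) (a : A) (x : X) :
    ∃ P : Matrix E E ℂ, P.IsHermitian ∧ (∀ b y, Commute ((Γ.S b).op y) P) ∧
      (Γ.R a).op x ⊗ₖ (1 : Matrix E E ℂ) * Γ.γ = (1 : Matrix D D ℂ) ⊗ₖ P * Γ.γ := by
  classical
  set σ := traceFirst Γ.γ with hσdef
  have hσd := (Matrix.isUnit_iff_isUnit_det _).1 hσ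
  have hσh : σ.IsHermitian := (posSemidef_traceFirst Γ.γ_posSemidef).isHermitian
  have hh : ∀ x, (Γ.steered a x).IsHermitian := fun x => (Γ.posSemidef_steered a x).isHermitian
  have hmul : σ * σ⁻¹ = 1 := Matrix.mul_nonsing_inv _ hσd
  have hmul' : σ⁻¹ * σ = 1 := Matrix.nonsing_inv_mul _ hσd
  have orth : ∀ x x', x ≠ x' → Γ.steered a x * Γ.steered a x' = 0 := by
    intro x x' hx
    obtain ⟨b⟩ := ‹Nonempty B›
    rw [← Matrix.mul_one (Γ.steered a x), ← (Γ.S b).sum_eq_one, Finset.mul_sum, Finset.sum_mul]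
    exact Finset.sum_eq_zero fun y _ => h a b y x x' hx
  have hσl : ∀ x, σ * Γ.steered a x = Γ.steered a x * Γ.steered a x := by
    intro x
    rw [hσdef, ← Γ.sum_steered a, Finset.sum_mul]
    exact Finset.sum_eq_single x (fun x' _ hx' => orth x' x hx') (by simp)
  have hσr : ∀ x, Γ.steered a x * σ = Γ.steered a x * Γ.steered a x := by
    intro x
    rw [hσdef, ← Γ.sum_steered a, Finset.mul_sum]
    exact Finset.sum_eq_single x (fun x' _ hx' => orth x x' hx'.symm) (by simp)
  set P : X → Matrix E E ℂ := fun x => Γ.steered a x * σ⁻¹ with hP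
  have hP' : ∀ x, P x = σ⁻¹ * Γ.steered a x := by
    intro x
    calc P x = σ⁻¹ * (σ * Γ.steered a x) * σ⁻¹ := by
          rw [← Matrix.mul_assoc, hmul', Matrix.one_mul]
      _ = σ⁻¹ * Γ.steered a x := by
          rw [hσl, ← hσr, Matrix.mul_assoc, Matrix.mul_assoc, hmul, Matrix.mul_one]
  have hPh : ∀ x, (P x).IsHermitian := by
    intro x
    rw [Matrix.IsHermitian, Matrix.conjTranspose_mul, (hh x).eq, hσh.inv.eq, hP']
  have hPP : ∀ x, P x * P x = P x := by
    intro x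
    nth_rw 1 [hP' x]
    rw [hP, ← Matrix.mul_assoc, Matrix.mul_assoc σ⁻¹, ← hσl, ← Matrix.mul_assoc, hmul',
      Matrix.one_mul]
  have hPsum : ∑ x, P x = 1 := by
    rw [hP, ← Finset.sum_mul, Γ.sum_steered, hmul]
  have hPS : ∀ b y x x', x ≠ x' → P x * (Γ.S b).op y * P x' = 0 := by
    intro b y x x' hx
    rw [hP' x, hP]
    calc σ⁻¹ * Γ.steered a x * (Γ.S b).op y * (Γ.steered a x' * σ⁻¹)
        = σ⁻¹ * (Γ.steered a x * (Γ.S b).op y * Γ.steered a x') * σ⁻¹ := by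
          simp only [Matrix.mul_assoc]
      _ = 0 := by rw [h a b y x x' hx, Matrix.mul_zero, Matrix.zero_mul]
  have hcomm : ∀ b y, Commute ((Γ.S b).op y) (P x) := by
    intro b y
    have h1 : (Γ.S b).op y * P x = P x * (Γ.S b).op y * P x := by
      conv_lhs => rw [← Matrix.one_mul ((Γ.S b).op y), ← hPsum, Finset.sum_mul, Finset.sum_mul]
      exact Finset.sum_eq_single x (fun x' _ hx' => hPS b y x' x hx') (by simp)
    have h2 : P x * (Γ.S b).op y = P x * (Γ.S b).op y * P x := by
      conv_lhs => rw [← Matrix.mul_one (P x * (Γ.S b).op y), ← hPsum, Finset.mul_sum]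
      exact Finset.sum_eq_single x (fun x' _ hx' => hPS b y x x' hx'.symm) (by simp)
    exact h1.trans h2.symm
  have hPpos : ∀ x, (P x).PosSemidef := by
    intro x
    have := Matrix.posSemidef_conjTranspose_mul_self (P x)
    rwa [(hPh x).eq, hPP] at this
  -- The outcome of `P_a` on the second side always agrees with that of `R_a` on the first.
  have hRP : ∀ x x', x ≠ x' → (Γ.R a).op x ⊗ₖ P x' * Γ.γ = 0 := by
    intro x x' hx
    refine mul_eq_zero_of_trace_mul_eq_zero (((Γ.R a).posSemidef x).kronecker (hPpos x'))
      Γ.γ_posSemidef ?_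
    have h1 : (Γ.R a).op x ⊗ₖ P x' = (1 : Matrix D D ℂ) ⊗ₖ P x' *
        (Γ.R a).op x ⊗ₖ (1 : Matrix E E ℂ) := by
      rw [← Matrix.mul_kronecker_mul, Matrix.one_mul, Matrix.mul_one]
    have h2 := traceFirst_compress (P x') (1 : Matrix E E ℂ)
      ((Γ.R a).op x ⊗ₖ (1 : Matrix E E ℂ) * Γ.γ)
    rw [Matrix.one_kronecker_one, Matrix.mul_one, Matrix.mul_one] at h2
    rw [h1, Matrix.mul_assoc, ← trace_traceFirst, h2]
    change (P x' * Γ.steered a x).trace = 0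
    rw [hP' x', Matrix.mul_assoc, orth x' x hx.symm, Matrix.mul_zero, Matrix.trace_zero]
  refine ⟨P x, hPh x, hcomm, ?_⟩
  trans (Γ.R a).op x ⊗ₖ P x * Γ.γ
  · have h1 : (Γ.R a).op x ⊗ₖ (1 : Matrix E E ℂ) = ∑ x', (Γ.R a).op x ⊗ₖ P x' := by
      rw [← hPsum]
      ext ⟨d, e⟩ ⟨d', e'⟩
      simp [Matrix.sum_apply, Finset.mul_sum]
    rw [h1, Finset.sum_mul]
    exact Finset.sum_eq_single x (fun x' _ hx' => hRP x x' hx'.symm) (by simp)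
  · have h1 : (1 : Matrix D D ℂ) ⊗ₖ P x = ∑ x', (Γ.R a).op x' ⊗ₖ P x := by
      rw [← (Γ.R a).sum_eq_one]
      ext ⟨d, e⟩ ⟨d', e'⟩
      simp [Matrix.sum_apply, Finset.sum_mul]
    rw [h1, Finset.sum_mul]
    exact (Finset.sum_eq_single x (fun x' _ hx' => hRP x' x hx') (by simp)).symm

end Mirror

/-! ### Tracing out the mirrored measurements -/

section TraceOut

variable {A B X Y : Type*} [Fintype X] [Fintype Y]
variable {D E : Type} [Fintype D] [DecidableEq D] [Fintype E] [DecidableEq E]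
variable {k : ℕ}

/-- The matrix of the map `v ↦ ∑ l, (f l)ᴴ v ⊗ |l⟩`. -/
def frameMap {E : Type*} (f : Fin k → Matrix E E ℂ) : Matrix (E × Fin k) E ℂ :=
  Matrix.of fun p e => (f p.2).conjTranspose p.1 e

theorem frameMap_conjTranspose_mul_mul {E : Type*} [Fintype E] (f : Fin k → Matrix E E ℂ)
    (M : Matrix E E ℂ) :
    (frameMap f).conjTranspose * M ⊗ₖ (1 : Matrix (Fin k) (Fin k) ℂ) * frameMap f =
      ∑ l, f l * M * (f l).conjTranspose := by
  ext e e'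
  simp only [Matrix.mul_apply, Matrix.sum_apply, Fintype.sum_prod_type, frameMap, Matrix.of_apply,
    Matrix.conjTranspose_apply, star_star, Matrix.kroneckerMap_apply, Matrix.one_apply, mul_ite,
    mul_one, mul_zero, Finset.sum_ite_eq', Finset.mem_univ, if_true]
  exact Finset.sum_comm

theorem frameMap_conjTranspose_mul {f : Fin k → Matrix E E ℂ}
    (hf : ∑ l, f l * (f l).conjTranspose = 1) : (frameMap f).conjTranspose * frameMap f = 1 := by
  have h := frameMap_conjTranspose_mul_mul f 1
  rwa [Matrix.one_kronecker_one, Matrix.mul_one, Finset.sum_congr rfl fun l _ => by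
    rw [Matrix.mul_one], hf] at h

/-- The strategy in which the second player's space is enlarged by the map `frameMap f`, and he
measures only its first tensor factor. -/
def Strategy.enlarge (Γ : Strategy A B X Y D E) (f : Fin k → Matrix E E ℂ)
    (hf : ∑ l, f l * (f l).conjTranspose = 1) : Strategy A B X Y D (E × Fin k) where
  R := Γ.R
  S b :=
    { op := fun y => (Γ.S b).op y ⊗ₖ (1 : Matrix (Fin k) (Fin k) ℂ)
      posSemidef := fun y => ((Γ.S b).posSemidef y).kronecker Matrix.PosSemidef.one
      sum_eq_one := by
        rw [← Matrix.one_kronecker_one, ← (Γ.S b).sum_eq_one]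
        ext ⟨d, e⟩ ⟨d', e'⟩
        simp [Matrix.sum_apply, Finset.sum_mul] }
  γ := ((1 : Matrix D D ℂ) ⊗ₖ frameMap f) * Γ.γ * ((1 : Matrix D D ℂ) ⊗ₖ frameMap f).conjTranspose
  γ_posSemidef := Γ.γ_posSemidef.mul_mul_conjTranspose_same _
  γ_trace := by
    rw [Matrix.trace_mul_comm, ← Matrix.mul_assoc, Matrix.conjTranspose_kronecker,
      Matrix.conjTranspose_one, ← Matrix.mul_kronecker_mul, frameMap_conjTranspose_mul hf,
      Matrix.one_mul, Matrix.one_kronecker_one, Matrix.one_mul, Γ.γ_trace]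

theorem Strategy.isUnitaryEmbedding_enlarge (Γ : Strategy A B X Y D E) {f : Fin k → Matrix E E ℂ}
    (hf : ∑ l, f l * (f l).conjTranspose = 1)
    (hfS : ∀ b y l, Commute ((Γ.S b).op y) (f l)) :
    IsUnitaryEmbedding Γ (Γ.enlarge f hf) (1 : Matrix D D ℂ) (frameMap f) where
  isometry_left := by rw [Matrix.conjTranspose_one, Matrix.one_mul]
  isometry_right := frameMap_conjTranspose_mul hf
  state := rfl
  left a x := by rw [Matrix.conjTranspose_one, Matrix.one_mul, Matrix.mul_one]; rfl
  right b y := by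
    refine Eq.trans ?_ (frameMap_conjTranspose_mul_mul f ((Γ.S b).op y)).symm
    simp only [← (hfS b y _).eq, Matrix.mul_assoc]
    rw [← Finset.mul_sum, hf, Matrix.mul_one]

/-- The strategy `Γ` with its shared state averaged by the channel `M ↦ ∑ l, (f l)ᴴ M (f l)` on the
second player's side. -/
def Strategy.average (Γ : Strategy A B X Y D E) (f : Fin k → Matrix E E ℂ)
    (hf : ∑ l, f l * (f l).conjTranspose = 1) : Strategy A B X Y D E where
  R := Γ.R
  S := Γ.S
  γ := ∑ l, (1 : Matrix D D ℂ) ⊗ₖ (f l).conjTranspose * Γ.γ * (1 : Matrix D D ℂ) ⊗ₖ f l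
  γ_posSemidef := by
    refine Matrix.posSemidef_sum _ fun l _ => ?_
    have := Γ.γ_posSemidef.conjTranspose_mul_mul_same ((1 : Matrix D D ℂ) ⊗ₖ f l)
    rwa [Matrix.conjTranspose_kronecker, Matrix.conjTranspose_one] at this
  γ_trace := by
    have h : ∑ l, (1 : Matrix D D ℂ) ⊗ₖ (f l * (f l).conjTranspose) = 1 := by
      rw [← Matrix.one_kronecker_one, ← hf]
      ext ⟨d, e⟩ ⟨d', e'⟩
      simp [Matrix.sum_apply, Finset.mul_sum]
    rw [Matrix.trace_sum]
    calc ∑ l, ((1 : Matrix D D ℂ) ⊗ₖ (f l).conjTranspose * Γ.γ * (1 : Matrix D D ℂ) ⊗ₖ f l).trace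
        = ∑ l, ((1 : Matrix D D ℂ) ⊗ₖ (f l * (f l).conjTranspose) * Γ.γ).trace := by
          refine Finset.sum_congr rfl fun l _ => ?_
          rw [Matrix.trace_mul_comm, ← Matrix.mul_assoc, ← Matrix.mul_kronecker_mul,
            Matrix.one_mul]
      _ = 1 := by rw [← Matrix.trace_sum, ← Finset.sum_mul, h, Matrix.one_mul, Γ.γ_trace]

theorem Strategy.isPartialTraceRight_average (Γ : Strategy A B X Y D E)
    {f : Fin k → Matrix E E ℂ} (hf : ∑ l, f l * (f l).conjTranspose = 1) :
    IsPartialTraceRight (Γ.enlarge f hf) (Γ.average f hf) where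
  left _ _ := rfl
  right _ _ := rfl
  state d e d' e' := by
    simp only [average, enlarge, Matrix.sum_apply, Matrix.conjTranspose_kronecker,
      Matrix.conjTranspose_one, mul_one_kronecker_apply, one_kronecker_mul_apply, frameMap,
      Matrix.conjTranspose_apply, Matrix.of_apply, star_star]

/-- If the first player's measurement operators act on the shared state like Hermitian operators of
the second player that commute with his measurements, the strategy is essentially classical. -/
theorem Strategy.essentiallyClassical_of_mirror (Γ : Strategy A B X Y D E)
    (h : ∀ a x, ∃ P : Matrix E E ℂ, P.IsHermitian ∧ (∀ b y, Commute ((Γ.S b).op y) P) ∧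
      (Γ.R a).op x ⊗ₖ (1 : Matrix E E ℂ) * Γ.γ = (1 : Matrix D D ℂ) ⊗ₖ P * Γ.γ) :
    Γ.EssentiallyClassical := by
  obtain ⟨k, f, hfS, hf, hL⟩ := exists_frame_commutant (fun p : B × Y => (Γ.S p.1).op p.2)
    fun p => ((Γ.S p.1).posSemidef p.2).isHermitian
  have h₁ : Step ⟨Γ⟩ ⟨Γ.enlarge f hf⟩ :=
    .embedding _ _ _ _ (Γ.isUnitaryEmbedding_enlarge hf fun b y l => hfS (b, y) l)
  have h₂ : Step ⟨Γ.enlarge f hf⟩ ⟨Γ.average f hf⟩ :=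
    .traceRight _ _ (Γ.isPartialTraceRight_average hf)
  have h₃ : Congruent ⟨Γ⟩ ⟨Γ.average f hf⟩ :=
    Relation.ReflTransGen.head (Or.inl h₁) (Relation.ReflTransGen.single (Or.inl h₂))
  refine ⟨D, E, _, _, _, _, Γ.average f hf, h₃, ?_⟩
  intro a x
  obtain ⟨P, hP, hPS, hRP⟩ := h a x
  obtain ⟨L, hLh, hPf⟩ := hL P hP fun p => hPS p.1 p.2
  have hfP : ∀ m, (f m).conjTranspose * P = ∑ l, L m l • (f l).conjTranspose := by
    intro m
    have := congrArg Matrix.conjTranspose (hPf m)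
    rw [Matrix.conjTranspose_mul, hP.eq, Matrix.conjTranspose_sum] at this
    rw [this]
    refine Finset.sum_congr rfl fun l _ => ?_
    rw [Matrix.conjTranspose_smul, hLh.apply]
  have hPR : Γ.γ * (Γ.R a).op x ⊗ₖ (1 : Matrix E E ℂ) = Γ.γ * (1 : Matrix D D ℂ) ⊗ₖ P := by
    have := congrArg Matrix.conjTranspose hRP
    rwa [Matrix.conjTranspose_mul, Matrix.conjTranspose_mul, Γ.γ_posSemidef.isHermitian.eq,
      Matrix.conjTranspose_kronecker, Matrix.conjTranspose_kronecker, Matrix.conjTranspose_one,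
      Matrix.conjTranspose_one, hP.eq, ((Γ.R a).posSemidef x).isHermitian.eq] at this
  have kron_sum : ∀ (c : Fin k → ℂ) (g : Fin k → Matrix E E ℂ),
      (1 : Matrix D D ℂ) ⊗ₖ (∑ l, c l • g l) = ∑ l, c l • (1 : Matrix D D ℂ) ⊗ₖ g l := by
    intro c g
    ext ⟨d, e⟩ ⟨d', e'⟩
    simp only [Matrix.sum_apply, Matrix.smul_apply, Matrix.kroneckerMap_apply, Finset.mul_sum,
      smul_eq_mul]
    exact Finset.sum_congr rfl fun l _ => mul_left_comm _ _ _
  have right : ∀ m, (1 : Matrix D D ℂ) ⊗ₖ (f m).conjTranspose * Γ.γ * (1 : Matrix D D ℂ) ⊗ₖ f m *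
      (Γ.R a).op x ⊗ₖ (1 : Matrix E E ℂ) =
        ∑ l, L l m • ((1 : Matrix D D ℂ) ⊗ₖ (f m).conjTranspose * Γ.γ *
          (1 : Matrix D D ℂ) ⊗ₖ f l) := by
    intro m
    have hc : (1 : Matrix D D ℂ) ⊗ₖ f m * (Γ.R a).op x ⊗ₖ (1 : Matrix E E ℂ) =
        (Γ.R a).op x ⊗ₖ (1 : Matrix E E ℂ) * (1 : Matrix D D ℂ) ⊗ₖ f m := by
      simp only [← Matrix.mul_kronecker_mul, Matrix.one_mul, Matrix.mul_one]
    rw [Matrix.mul_assoc, hc, ← Matrix.mul_assoc, Matrix.mul_assoc _ Γ.γ, hPR, Matrix.mul_assoc,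
      Matrix.mul_assoc Γ.γ, ← Matrix.mul_kronecker_mul, Matrix.one_mul, hPf, kron_sum,
      Finset.mul_sum, Finset.mul_sum]
    simp only [Matrix.mul_smul, Matrix.mul_assoc]
  have left : ∀ m, (Γ.R a).op x ⊗ₖ (1 : Matrix E E ℂ) * ((1 : Matrix D D ℂ) ⊗ₖ (f m).conjTranspose *
      Γ.γ * (1 : Matrix D D ℂ) ⊗ₖ f m) =
        ∑ l, L m l • ((1 : Matrix D D ℂ) ⊗ₖ (f l).conjTranspose * Γ.γ *
          (1 : Matrix D D ℂ) ⊗ₖ f m) := by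
    intro m
    have hc : (Γ.R a).op x ⊗ₖ (1 : Matrix E E ℂ) * (1 : Matrix D D ℂ) ⊗ₖ (f m).conjTranspose =
        (1 : Matrix D D ℂ) ⊗ₖ (f m).conjTranspose * (Γ.R a).op x ⊗ₖ (1 : Matrix E E ℂ) := by
      simp only [← Matrix.mul_kronecker_mul, Matrix.one_mul, Matrix.mul_one]
    rw [← Matrix.mul_assoc, ← Matrix.mul_assoc, hc, Matrix.mul_assoc _ _ Γ.γ, hRP,
      ← Matrix.mul_assoc, ← Matrix.mul_kronecker_mul, Matrix.one_mul, hfP, kron_sum,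
      Finset.sum_mul, Finset.sum_mul]
    simp only [Matrix.smul_mul]
  change (∑ l, (1 : Matrix D D ℂ) ⊗ₖ (f l).conjTranspose * Γ.γ * (1 : Matrix D D ℂ) ⊗ₖ f l) *
      (Γ.R a).op x ⊗ₖ (1 : Matrix E E ℂ) = (Γ.R a).op x ⊗ₖ (1 : Matrix E E ℂ) *
      ∑ l, (1 : Matrix D D ℂ) ⊗ₖ (f l).conjTranspose * Γ.γ * (1 : Matrix D D ℂ) ⊗ₖ f l
  rw [Finset.mul_sum, Finset.sum_mul]
  simp only [left, right]
  exact Finset.sum_comm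

end TraceOut

end GuessingGame

end

theorem theorem3 {A B X Y : Type*} [Fintype A] [Fintype B] [Fintype X] [Fintype Y]
    (G : GuessingGame.Game A B X Y) (hG : G.CompleteSupport)
    {D E : Type} [Fintype D] [DecidableEq D] [Fintype E] [DecidableEq E]
    (Γ : GuessingGame.Strategy A B X Y D E) (hΓ : Γ.AllowsPerfectGuessing) :
    Γ.EssentiallyClassical := by
  have : Nonempty B := by
    by_contra hB
    rw [not_nonempty_iff] at hB
    simpa using G.q_sum
  obtain ⟨F, _, _, j, hj, hγ, hσ⟩ := Γ.exists_restrict_isUnit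
  obtain ⟨D', E', _, _, _, _, Γ', hΓ', hcomm⟩ :=
    (Γ.restrict j hj hγ).essentiallyClassical_of_mirror
      fun a x => (hΓ.steeredOrthogonal.restrict hj hγ).exists_mirror hσ a x
  have h₁ : GuessingGame.Step ⟨Γ.restrict j hj hγ⟩ ⟨Γ⟩ :=
    .embedding _ _ _ _ (Γ.isUnitaryEmbedding_restrict hj hγ)
  exact ⟨D', E', _, _, _, _, Γ', Relation.ReflTransGen.head (Or.inr h₁) hΓ', hcomm⟩
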